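/- Let $q$ be a prime power, let $R=\mathbf F_q[[T]]$ and $K=\mathbf F_q((T))$ with the absolute value $|x|=q^{-v_T(x)}$, and let $C(R,K)$ be the $K$-Banach space of continuous functions $f:R\to K$ with the sup-norm $\|f\|=\max_{x\in R}|f(x)|$. A sequence $(b_n)_{n\ge 0}$ in $C(R,K)$ is called an orthonormal basis if every $f\in C(R,K)$ has a unique expansion $f=\sum_{n\ge 0}a_nb_n$ with $a_n\in K$, $a_n\to 0$ (convergence in the sup-norm), and for this expansion $\|f\|=\max_n|a_n|$. For $n\ge 0$ let $k$ be the number of $q$-adic digits of $n$ (so $q^{k-1}\le n<q^k$ for $n\geq 1$, and $k=0$ for $n=0$), and for $x=\sum_{i\ge 0}x_iT^i\in R$ put $$\psi_n(x)=\sum_{i\ge 0}x_{iq^k+n}T^i,\qquad \phi_n(x)=\psi_n(x)^{q^k}=\sum_{i\ge 0}x_{iq^k+n}T^{iq^k}.$$ For a sequence $(f_i)_{i\ge 0}$ in $C(R,K)$ and an integer $n\ge 0$ with $q$-adic expansion $n=n_0+n_1q+\dots+n_{s-1}q^{s-1}$, $0\le n_i<q$, put $$\mathcal F_n=\prod_{i=0}^{s-1}f_i^{n_i},\qquad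 \mathcal F_n^*=\prod_{i=0}^{s-1}g_{i},\qquad g_i=\begin{cases}f_i^{q-1}-1 & \text{if } n_i=q-1,\\ f_i^{n_i} & \text{if } n_i<q-1,\end{cases}$$ so that $\mathcal F_0=\mathcal F_0^*=1$. Write $(\Phi_n,\Phi_n^*)$ for $(\mathcal F_n,\mathcal F_n^*)$ when $f_i=\phi_i$, and $(\Psi_n,\Psi_n^*)$ when $f_i=\psi_i$. **Theorem.** Let $(\mathcal F_n,\mathcal F_n^*)=(\Phi_n,\Phi_n^*)$ or $(\Psi_n,\Psi_n^*)$. 1. $\{\mathcal F_n\}_{n\ge 0}$ is an orthonormal basis of $C(R,K)$. 2. If $f\in C(R,K)$ is written as $f=\sum_{n\ge 0}c_n\mathcal F_n$ with $c_n\to0$, then for every $n\ge 0$ and every integer $w\ge 0$ with $q^w>n$, $$c_n=(-1)^w\sum_{\alpha\in A_w}\mathcal F^*_{q^w-1-n}(\alpha)\,f(\alpha),$$ where $A_w$ is the set of all polynomials in $\mathbf F_q[T]$ of degree $<w$ (including $0$). -/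

import Mathlib

open scoped PowerSeries LaurentSeries PowerSeries.WithPiTopology

noncomputable section

/-! ### Orthonormal bases in the non-Archimedean sense -/

section Orthonormal

variable {K E : Type*} [NormedField K] [NormedAddCommGroup E] [NormedSpace K E]

/-- `f = ∑ aₙ bₙ` with `aₙ → 0`: the coefficients form a null sequence and the partial sums of the
series converge to `f` in `E`. -/
structure IsExpansion (b : ℕ → E) (a : ℕ → K) (f : E) : Prop where
  tendsto_zero : Filter.Tendsto a Filter.atTop (nhds 0)
  tendsto_sum :
    Filter.Tendsto (fun N : ℕ => ∑ n ∈ Finset.range N, a n • b n) Filter.atTop (nhds f)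

variable (K) in
/-- Orthonormal basis of a Banach space over a non-Archimedean field: every `f` has exactly one
expansion `f = ∑ aₙ bₙ` with `aₙ → 0`, and then `‖f‖ = max |aₙ|` (the maximum being attained). -/
structure IsOrthonormalBasis (b : ℕ → E) : Prop where
  existsUnique_expansion : ∀ f : E, ∃! a : ℕ → K, IsExpansion b a f
  norm_eq_max : ∀ (f : E) (a : ℕ → K), IsExpansion b a f →
    IsGreatest (Set.range fun n => ‖a n‖) ‖f‖

end Orthonormal

/-! ### The local field `F((T))` and its ring of integers `F[[T]]` -/

section LocalField

variable (F : Type*) [Field F] [Fintype F]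

lemma one_lt_card_nnreal : (1 : NNReal) < (Fintype.card F : NNReal) := by
  exact_mod_cast Fintype.one_lt_card (α := F)

open MonoidWithZeroHom in
/-- The `T`-adic valuation on `F((T))`, made real-valued so that `|T| = q⁻¹`, `q = #F`. -/
instance laurentRankOne : Valuation.RankOne (Valued.v : Valuation F⸨X⸩ (WithZero (Multiplicative ℤ)))
    where
  hom' := (WithZeroMulInt.toNNReal (one_lt_card_nnreal F).ne_zero).comp ValueGroup₀.embedding
  strictMono' :=
    (WithZeroMulInt.toNNReal_strictMono (one_lt_card_nnreal F)).comp
      ValueGroup₀.embedding_strictMono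
  exists_val_nontrivial := by
    obtain ⟨x, hx⟩ := LaurentSeries.valuation_surjective F (WithZero.exp (1 : ℤ))
    refine ⟨x, ?_, ?_⟩
    · rw [hx]; exact WithZero.exp_ne_zero
    · rw [hx]; intro h
      rw [← WithZero.exp_zero, WithZero.exp_inj] at h
      exact one_ne_zero h

/-- `F((T))` as a normed field, with its `T`-adic topology and `|x| = q ^ (-v(x))`. -/
instance laurentNormedField : NormedField F⸨X⸩ :=
  Valued.toNormedField F⸨X⸩ (WithZero (Multiplicative ℤ))

variable {F}

lemma laurent_norm_eq (x : F⸨X⸩) :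
    ‖x‖ = WithZeroMulInt.toNNReal (one_lt_card_nnreal F).ne_zero (Valued.v x) := by
  rw [Valued.toNormedField.norm_def]
  simp only [Valuation.RankOne.hom, Valuation.RankLeOne.hom']
  congr 1
  simp [Valuation.restrict_def]

variable [TopologicalSpace F] [DiscreteTopology F]

/-- With `F` discrete, `F[[T]]` (topology of coefficientwise convergence) is compact. -/
instance powerSeriesCompactSpace : CompactSpace F⟦X⟧ :=
  inferInstanceAs (CompactSpace ((Unit →₀ ℕ) → F))

lemma continuous_coe_laurent : Continuous (fun x : F⟦X⟧ => (x : F⸨X⸩)) := by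
  refine continuous_of_continuousAt_zero (HahnSeries.ofPowerSeries ℤ F) ?_
  unfold ContinuousAt
  rw [map_zero, Metric.nhds_basis_ball.tendsto_right_iff]
  intro ε hε
  have hq : (1 : ℝ) < (Fintype.card F : ℝ) := by exact_mod_cast Fintype.one_lt_card (α := F)
  obtain ⟨d, hd⟩ := exists_pow_lt_of_lt_one hε (inv_lt_one_of_one_lt₀ hq)
  have hopen : ∀ n : ℕ, ∀ᶠ x : F⟦X⟧ in nhds 0, PowerSeries.coeff n x = 0 := by
    intro n
    have h := (PowerSeries.WithPiTopology.continuous_coeff F n).tendsto 0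
    rw [map_zero, nhds_discrete F, Filter.tendsto_pure] at h
    exact h
  have hall : ∀ᶠ x : F⟦X⟧ in nhds 0, ∀ n ∈ Finset.range d, PowerSeries.coeff n x = 0 :=
    (Filter.eventually_all_finset _).2 fun n _ => hopen n
  filter_upwards [hall] with x hx
  have hv := (LaurentSeries.intValuation_le_iff_coeff_lt_eq_zero F (d := d) x).2
    fun n hn => hx n (Finset.mem_range.2 hn)
  rw [mem_ball_zero_iff, laurent_norm_eq]
  refine lt_of_le_of_lt ?_ hd
  have hm := (WithZeroMulInt.toNNReal_strictMono (one_lt_card_nnreal F)).monotone hv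
  have he : WithZeroMulInt.toNNReal (one_lt_card_nnreal F).ne_zero (WithZero.exp (-(d : ℤ))) =
      ((Fintype.card F : NNReal)⁻¹) ^ d := by
    rw [WithZeroMulInt.toNNReal_neg_apply _ WithZero.exp_ne_zero]
    have hu : Multiplicative.toAdd (WithZero.unzero (WithZero.exp_ne_zero (a := -(d : ℤ)))) =
        -(d : ℤ) := rfl
    rw [hu]
    simp
  rw [he] at hm
  exact_mod_cast hm

/-- The topology used on `F[[T]]` is the subspace topology from `F((T))`. -/
lemma isInducing_coe_laurent : Topology.IsInducing (fun x : F⟦X⟧ => (x : F⸨X⸩)) := by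
  refine Topology.isInducing_iff_nhds.2 fun x =>
    le_antisymm continuous_coe_laurent.continuousAt.le_comap ?_
  rw [← Filter.tendsto_id']
  refine (PowerSeries.WithPiTopology.tendsto_iff_coeff_tendsto (R := F) id _ x).2 fun d => ?_
  have h : Continuous fun y : F⸨X⸩ => y.coeff (d : ℤ) := by
    rw [‹DiscreteTopology F›.eq_bot]
    letI uF : UniformSpace F := ⊥
    exact (LaurentSeries.uniformContinuous_coeff (K := F) (uK := uF) (d : ℤ)).continuous
  have h2 := (h.tendsto (x : F⸨X⸩)).comp
    (Filter.tendsto_comap (f := fun x : F⟦X⟧ => (x : F⸨X⸩)))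
  simpa [Function.comp_def, LaurentSeries.coeff_coe_powerSeries] using h2

end LocalField

/-! ### Cartier operators -/

section Cartier

variable {F : Type*} [Field F] [Fintype F]

/-- The Cartier operator `Δ_{r,m} (∑ xₙ Tⁿ) = ∑ x_{n q^m + r} Tⁿ` on `F[[T]]`, `q = #F`. -/
def cartierOp (r m : ℕ) (x : F⟦X⟧) : F⟦X⟧ :=
  PowerSeries.mk fun n => PowerSeries.coeff (n * Fintype.card F ^ m + r) x

variable (F) in
/-- The number `k` of `q`-adic digits of `n`, so that `q^(k-1) ≤ n < q^k`, and `k = 0` for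
`n = 0`. -/
def numDigits (n : ℕ) : ℕ := (Nat.digits (Fintype.card F) n).length

variable [TopologicalSpace F]

lemma continuous_cartierOp (r m : ℕ) : Continuous (cartierOp (F := F) r m) := by
  rw [continuous_iff_continuousAt]
  intro x
  refine (PowerSeries.WithPiTopology.tendsto_iff_coeff_tendsto (R := F) _ _ _).2 fun d => ?_
  simp only [cartierOp, PowerSeries.coeff_mk]
  exact (PowerSeries.WithPiTopology.continuous_coeff F _).tendsto x

variable (F) [DiscreteTopology F]

/-- `φₙ = Δ_{n,k}^{q^k}` (the `q^k`-th power of the value), as an element of `C(F[[T]], F((T)))`. -/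
def cartierPhi (n : ℕ) : C(F⟦X⟧, F⸨X⸩) where
  toFun x := ((cartierOp n (numDigits F n) x ^ Fintype.card F ^ numDigits F n : F⟦X⟧) : F⸨X⸩)
  continuous_toFun := continuous_coe_laurent.comp ((continuous_cartierOp _ _).pow _)

/-- `ψₙ = Δ_{n,k}`, as an element of `C(F[[T]], F((T)))`. -/
def cartierPsi (n : ℕ) : C(F⟦X⟧, F⸨X⸩) where
  toFun x := (cartierOp n (numDigits F n) x : F⸨X⸩)
  continuous_toFun := continuous_coe_laurent.comp (continuous_cartierOp _ _)

/-! ### `q`-adic extensions -/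

variable {F}

/-- The `q`-adic extension `∏ fᵢ ^ nᵢ` of `(fᵢ)`, where `n = ∑ nᵢ qⁱ` is the `q`-adic expansion,
that is, `nᵢ = ⌊n / qⁱ⌋ mod q`. -/
def digitExt (f : ℕ → C(F⟦X⟧, F⸨X⸩)) (n : ℕ) : C(F⟦X⟧, F⸨X⸩) :=
  ∏ i ∈ Finset.range (numDigits F n),
    f i ^ (n / Fintype.card F ^ i % Fintype.card F)

/-- The companion `∏ F*_{nᵢ qⁱ}` of the `q`-adic extension: the factor is `fᵢ ^ (q-1) - 1` if
`nᵢ = q - 1`, and `fᵢ ^ nᵢ` if `nᵢ < q - 1`. -/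
def digitExtStar (f : ℕ → C(F⟦X⟧, F⸨X⸩)) (n : ℕ) : C(F⟦X⟧, F⸨X⸩) :=
  ∏ i ∈ Finset.range (numDigits F n),
    if n / Fintype.card F ^ i % Fintype.card F = Fintype.card F - 1 then
      f i ^ (Fintype.card F - 1) - 1
    else f i ^ (n / Fintype.card F ^ i % Fintype.card F)

end Cartier

/-! ### Polynomials of bounded degree -/

section Poly

variable (F : Type*) [Field F] [Fintype F]

lemma finite_polys_degree_lt (w : ℕ) : {α : Polynomial F | α.degree < w}.Finite := by
  have : Finite (Polynomial.degreeLT F w) :=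
    Finite.of_equiv _ (Polynomial.degreeLTEquiv F w).toEquiv.symm
  refine Set.Finite.subset (Set.toFinite (Polynomial.degreeLT F w : Set (Polynomial F))) ?_
  intro α hα
  exact Polynomial.mem_degreeLT.2 hα

/-- The finite set `A_w` of all polynomials over `F` of degree `< w` (including `0`). -/
def polysDegreeLT (w : ℕ) : Finset (Polynomial F) := (finite_polys_degree_lt F w).toFinset

end Poly

end

noncomputable section

section Biorthogonal

variable {K E : Type*} [NormedField K] [NormedAddCommGroup E] [NormedSpace K E]

lemma IsExpansion.eq_dual {b : ℕ → E} {a : ℕ → K} {f : E} (h : IsExpansion b a f) {n : ℕ}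
    (c : E →ₗ[K] K) (hc : ∀ x, ‖c x‖ ≤ ‖x‖) (hcb : ∀ m, c (b m) = if m = n then 1 else 0) :
    a n = c f := by
  have hcont : Continuous c :=
    AddMonoidHomClass.continuous_of_bound c 1 fun x => by simpa using hc x
  refine tendsto_nhds_unique (f := fun _ : ℕ => a n) tendsto_const_nhds
    (((hcont.tendsto f).comp h.tendsto_sum).congr' ?_)
  filter_upwards [Filter.eventually_gt_atTop n] with M hM
  simp [hcb, hM]

lemma dense_span_of_approx {b : ℕ → E} {θ : ℝ} (hθ : θ < 1)
    (happ : ∀ f : E, ∃ d ∈ Submodule.span K (Set.range b), ‖f - d‖ ≤ θ * ‖f‖) (f : E) :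
    f ∈ (Submodule.span K (Set.range b)).topologicalClosure := by
  by_contra hf
  obtain ⟨r, hθr, hr⟩ := exists_between hθ
  obtain ⟨x, hx, hxy⟩ := riesz_lemma (Submodule.isClosed_topologicalClosure _) ⟨f, hf⟩ hr
  obtain ⟨d, hd, hxd⟩ := happ x
  have h := (hxy d (Submodule.le_topologicalClosure _ hd)).trans hxd
  have hx0 : 0 < ‖x‖ := norm_pos_iff.2 fun h0 => hx (h0 ▸ Submodule.zero_mem _)
  exact absurd (le_of_mul_le_mul_right h hx0) (not_le.2 hθr)

/-- A sequence in the unit ball which has a dual sequence of functionals of norm at most `1`, and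
whose span approximates every vector up to a fixed factor `θ < 1`, is an orthonormal basis. -/
theorem isOrthonormalBasis_of_dual [IsUltrametricDist E] {b : ℕ → E} {c : ℕ → E →ₗ[K] K}
    (hb : ∀ n, ‖b n‖ ≤ 1) (hc : ∀ n x, ‖c n x‖ ≤ ‖x‖)
    (hcb : ∀ n m, c n (b m) = if m = n then 1 else 0) {θ : ℝ} (hθ : θ < 1)
    (happ : ∀ f : E, ∃ d ∈ Submodule.span K (Set.range b), ‖f - d‖ ≤ θ * ‖f‖) :
    IsOrthonormalBasis K b := by
  have hle : ∀ (f : E) N, ‖∑ n ∈ Finset.range N, c n f • b n‖ ≤ ‖f‖ := fun f N =>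
    IsUltrametricDist.norm_sum_le_of_forall_le_of_nonneg (norm_nonneg f) fun n _ => by
      rw [norm_smul]
      exact (mul_le_mul (hc n f) (hb n) (norm_nonneg _) (norm_nonneg _)).trans_eq (mul_one _)
  have hspan : ∀ d ∈ Submodule.span K (Set.range b), ∃ N, ∀ M ≥ N,
      ∑ n ∈ Finset.range M, c n d • b n = d ∧ c M d = 0 := by
    intro d hd
    induction hd using Submodule.span_induction with
    | mem x hx =>
      obtain ⟨m, rfl⟩ := hx
      refine ⟨m + 1, fun M hM => ?_⟩
      have h1 : m < M := hM
      simp [hcb, h1, h1.ne]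
    | zero => exact ⟨0, fun M _ => by simp⟩
    | add x y _ _ hx hy =>
      obtain ⟨N₁, h₁⟩ := hx
      obtain ⟨N₂, h₂⟩ := hy
      refine ⟨max N₁ N₂, fun M hM => ?_⟩
      have hx := h₁ M (le_of_max_le_left hM)
      have hy := h₂ M (le_of_max_le_right hM)
      simp [add_smul, Finset.sum_add_distrib, hx, hy]
    | smul r x _ hx =>
      obtain ⟨N, h⟩ := hx
      refine ⟨N, fun M hM => ?_⟩
      simp [mul_smul, ← Finset.smul_sum, h M hM]
  have hexp : ∀ f : E, IsExpansion b (fun n => c n f) f := by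
    intro f
    have key : ∀ ε > 0, ∃ N, ∀ M ≥ N,
        ‖∑ n ∈ Finset.range M, c n f • b n - f‖ < ε ∧ ‖c M f‖ < ε := by
      intro ε hε
      obtain ⟨d, hd, hfd⟩ := Metric.mem_closure_iff.1 (dense_span_of_approx hθ happ f) ε hε
      rw [dist_eq_norm] at hfd
      obtain ⟨N, hN⟩ := hspan d hd
      refine ⟨N, fun M hM => ⟨?_, ?_⟩⟩
      · have heq : ∑ n ∈ Finset.range M, c n f • b n - f =
            ∑ n ∈ Finset.range M, c n (f - d) • b n - (f - d) := by
          simp only [map_sub, sub_smul, Finset.sum_sub_distrib, (hN M hM).1]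
          abel
        rw [heq, sub_eq_add_neg]
        refine (IsUltrametricDist.norm_add_le_max _ _).trans_lt ?_
        rw [norm_neg]
        exact max_lt ((hle _ _).trans_lt hfd) hfd
      · have heq : c M f = c M (f - d) := by rw [map_sub, (hN M hM).2, sub_zero]
        rw [heq]
        exact (hc _ _).trans_lt hfd
    constructor
    · refine Metric.tendsto_atTop.2 fun ε hε => ?_
      obtain ⟨N, hN⟩ := key ε hε
      exact ⟨N, fun M hM => by simpa using (hN M hM).2⟩
    · refine Metric.tendsto_atTop.2 fun ε hε => ?_
      obtain ⟨N, hN⟩ := key ε hε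
      exact ⟨N, fun M hM => by simpa [dist_eq_norm] using (hN M hM).1⟩
  refine ⟨fun f => ⟨fun n => c n f, hexp f, fun a ha => ?_⟩, fun f a ha => ?_⟩
  · funext n
    exact ha.eq_dual (c n) (hc n) (hcb n)
  · have hale : ∀ n, ‖a n‖ ≤ ‖f‖ := fun n => by
      rw [ha.eq_dual (c n) (hc n) (hcb n)]
      exact hc n f
    have hmax : ∃ n, ∀ m, ‖a m‖ ≤ ‖a n‖ := by
      by_cases h0 : ∀ m, a m = 0
      · exact ⟨0, fun m => by simp [h0]⟩
      · push Not at h0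
        obtain ⟨m₀, hm₀⟩ := h0
        obtain ⟨N, hN⟩ := Metric.tendsto_atTop.1 ha.tendsto_zero _ (norm_pos_iff.2 hm₀)
        obtain ⟨n, hn, hmax⟩ := Finset.exists_max_image (Finset.range (N + m₀ + 1)) (fun m => ‖a m‖)
          ⟨0, by simp⟩
        refine ⟨n, fun m => ?_⟩
        by_cases hm : m < N + m₀ + 1
        · exact hmax m (Finset.mem_range.2 hm)
        · have h1 := hN m (by omega)
          rw [dist_zero_right] at h1
          exact h1.le.trans (hmax m₀ (Finset.mem_range.2 (by omega)))
    obtain ⟨n, hn⟩ := hmax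
    refine ⟨⟨n, (hale n).antisymm ?_⟩, ?_⟩
    · refine le_of_tendsto ha.tendsto_sum.norm (Filter.Eventually.of_forall fun N => ?_)
      refine IsUltrametricDist.norm_sum_le_of_forall_le_of_nonneg (norm_nonneg _) fun m _ => ?_
      rw [norm_smul]
      exact (mul_le_mul (hn m) (hb m) (norm_nonneg _) (norm_nonneg _)).trans_eq (mul_one _)
    · rintro _ ⟨m, rfl⟩
      exact hale m

end Biorthogonal

section Digits

lemma digit_pow_sub_one_sub {q : ℕ} (hq : 0 < q) :
    ∀ {w n i : ℕ}, n < q ^ w → i < w → (q ^ w - 1 - n) / q ^ i % q = q - 1 - n / q ^ i % q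
  | 0, _, _, _, hi => absurd hi (Nat.not_lt_zero _)
  | w + 1, n, i, hn, hi => by
    have hdiv : n / q < q ^ w := Nat.div_lt_of_lt_mul (by rwa [pow_succ'] at hn)
    have hmod : n % q < q := Nat.mod_lt _ hq
    have hsplit : q ^ (w + 1) - 1 - n = (q - 1 - n % q) + q * (q ^ w - 1 - n / q) := by
      obtain ⟨d, hd⟩ := Nat.exists_eq_add_of_lt hdiv
      have h1 := Nat.div_add_mod n q
      have h2 : q ^ w - 1 - n / q = d := by omega
      have h3 : q ^ (w + 1) = q * (n / q) + q * d + q := by rw [pow_succ', hd]; ring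
      rw [h2]
      omega
    have hlt : q - 1 - n % q < q := by omega
    cases i with
    | zero => simp [hsplit, Nat.mod_eq_of_lt hlt]
    | succ i =>
      rw [hsplit, pow_succ' q i, ← Nat.div_div_eq_div_mul, ← Nat.div_div_eq_div_mul,
        Nat.add_mul_div_left _ _ hq, Nat.div_eq_of_lt hlt, zero_add]
      exact digit_pow_sub_one_sub hq hdiv (Nat.lt_of_succ_lt_succ hi)

lemma eq_of_digits_eq {q : ℕ} :
    ∀ {w n m : ℕ}, n < q ^ w → m < q ^ w → (∀ i < w, n / q ^ i % q = m / q ^ i % q) → n = m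
  | 0, _, _, hn, hm, _ => by simp at hn hm; omega
  | w + 1, n, m, hn, hm, h => by
    have h0 : n % q = m % q := by simpa using h 0 (Nat.succ_pos _)
    have h1 : n / q = m / q := by
      refine eq_of_digits_eq (Nat.div_lt_of_lt_mul (by rwa [pow_succ'] at hn))
        (Nat.div_lt_of_lt_mul (by rwa [pow_succ'] at hm)) fun i hi => ?_
      have := h (i + 1) (Nat.succ_lt_succ hi)
      rwa [pow_succ', ← Nat.div_div_eq_div_mul, ← Nat.div_div_eq_div_mul] at this
    rw [← Nat.div_add_mod n q, ← Nat.div_add_mod m q, h0, h1]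

end Digits

section Sums

/-- If the `i`-th factor depends only on the coordinates from `i` on and its sum over the `i`-th
coordinate is the constant `s i`, then the sum of the product is the product of the `s i`. -/
theorem sum_prod_eq_prod_of_triangular {F L : Type*} [Fintype F] [Inhabited F] [CommRing L] :
    ∀ {w : ℕ} (H : Fin w → (Fin w → F) → L) (s : Fin w → L),
      (∀ i a, ∑ x : F, H i (Function.update a i x) = s i) →
      (∀ i a b, (∀ j, i ≤ j → a j = b j) → H i a = H i b) →
      ∑ a : Fin w → F, ∏ i, H i a = ∏ i, s i
  | 0, H, s, _, _ => by simp
  | w + 1, H, s, hs, hH => by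
    have htail : ∀ (i : Fin w) (x y : F) (a : Fin w → F),
        H i.succ (Fin.cons x a) = H i.succ (Fin.cons y a) := fun i x y a => by
      refine hH _ _ _ fun j hj => ?_
      obtain ⟨k, rfl⟩ := Fin.exists_succ_eq.2
        (ne_of_gt (lt_of_lt_of_le (Fin.succ_pos i) hj))
      simp
    have ih := sum_prod_eq_prod_of_triangular
      (fun i a => H i.succ (Fin.cons default a)) (fun i => s i.succ)
      (fun i a => by
        rw [← hs i.succ (Fin.cons default a)]
        simp only [Fin.cons_update])
      (fun i a b hab => hH _ _ _ fun j hj => by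
        obtain ⟨k, rfl⟩ := Fin.exists_succ_eq.2
          (ne_of_gt (lt_of_lt_of_le (Fin.succ_pos i) hj))
        simpa using hab k (Fin.succ_le_succ_iff.1 hj))
    rw [← (Fin.consEquiv fun _ : Fin (w + 1) => F).sum_comp, Fintype.sum_prod_type_right,
      Fin.prod_univ_succ, ← ih, Finset.mul_sum]
    refine Finset.sum_congr rfl fun a _ => ?_
    simp only [Fin.prod_univ_succ]
    rw [← hs 0 (Fin.cons default a), Finset.sum_mul]
    refine Finset.sum_congr rfl fun x _ => ?_
    rw [Fin.update_cons_zero]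
    congr 1
    exact Finset.prod_congr rfl fun i _ => htail i _ _ _

variable {F L : Type*} [Field F] [Fintype F] [Field L] (ι : F →+* L) (c : L)

lemma sum_pow_card_sub_one : ∑ x : F, x ^ (Fintype.card F - 1) = -1 := by
  classical
  have hq : Fintype.card F - 1 ≠ 0 := (Nat.sub_pos_of_lt Fintype.one_lt_card).ne'
  rw [← Finset.add_sum_erase _ _ (Finset.mem_univ (0 : F)), zero_pow hq, zero_add,
    Finset.sum_congr rfl fun x hx =>
      FiniteField.pow_card_sub_one_eq_one x (Finset.ne_of_mem_erase hx)]
  simp [Finset.card_erase_of_mem, Nat.cast_sub Fintype.card_pos]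

lemma sum_translate_pow_eq {j : ℕ} (hj : j < Fintype.card F) :
    ∑ x : F, (ι x + c) ^ j = if j = Fintype.card F - 1 then -1 else 0 := by
  simp only [add_pow]
  rw [Finset.sum_comm]
  simp only [← map_pow, mul_assoc, ← Finset.sum_mul, ← map_sum]
  rw [Finset.sum_range_succ, Finset.sum_eq_zero, zero_add]
  · split_ifs with h
    · subst h; simp [sum_pow_card_sub_one]
    · rw [FiniteField.sum_pow_lt_card_sub_one _ _ (by omega)]; simp
  · intro m hm
    rw [FiniteField.sum_pow_lt_card_sub_one _ _ (by rw [Finset.mem_range] at hm; omega)]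
    simp

lemma sum_translate_pow_card_sub_one_add {d : ℕ} (hd : 0 < d) (hdq : d < Fintype.card F) :
    ∑ x : F, (ι x + c) ^ (Fintype.card F - 1 + d) = ∑ x : F, (ι x + c) ^ d := by
  have hfrob : ∀ x : F, (ι x + c) ^ Fintype.card F = (ι x + c) + (c ^ Fintype.card F - c) := by
    intro x
    obtain ⟨p, hp⟩ := CharP.exists F
    obtain ⟨n, hpr, hcard⟩ := FiniteField.card F p
    have : Fact p.Prime := ⟨hpr⟩
    have : CharP L p := charP_of_injective_ringHom ι.injective p
    have h1 : ι x ^ Fintype.card F = ι x := by rw [← map_pow, FiniteField.pow_card]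
    have h2 : (ι x + c) ^ Fintype.card F = ι x ^ Fintype.card F + c ^ Fintype.card F := by
      rw [hcard, add_pow_char_pow]
    rw [h2, h1]
    ring
  obtain ⟨e, rfl⟩ := Nat.exists_eq_succ_of_ne_zero hd.ne'
  have hstep : ∀ x : F, (ι x + c) ^ (Fintype.card F - 1 + (e + 1)) =
      (ι x + c) ^ (e + 1) + (c ^ Fintype.card F - c) * (ι x + c) ^ e := by
    intro x
    have : Fintype.card F - 1 + (e + 1) = Fintype.card F + e := by
      have := Fintype.card_pos (α := F)
      omega
    rw [this, pow_add, hfrob]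
    ring
  simp only [Nat.succ_eq_add_one, hstep, Finset.sum_add_distrib, ← Finset.mul_sum]
  rw [sum_translate_pow_eq ι c (j := e) (by omega), if_neg (by omega)]
  simp

/-- Orthogonality of the digit factors `y ^ d` and their companions, over a translate of `F`. -/
theorem sum_digit_factor {d e : ℕ} (hd : d < Fintype.card F) (he : e < Fintype.card F) :
    ∑ x : F, ((ι x + c) ^ d * if Fintype.card F - 1 - e = Fintype.card F - 1 then
        (ι x + c) ^ (Fintype.card F - 1) - 1 else (ι x + c) ^ (Fintype.card F - 1 - e)) =
      if d = e then -1 else 0 := by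
  have hq := Fintype.one_lt_card (α := F)
  by_cases he0 : e = 0
  · subst he0
    simp only [Nat.sub_zero, if_true, mul_sub, mul_one, ← pow_add, Finset.sum_sub_distrib]
    rcases Nat.eq_zero_or_pos d with rfl | hd0
    · rw [zero_add, sum_translate_pow_eq ι c (by omega), sum_translate_pow_eq ι c (by omega)]
      simp only [if_true]
      rw [if_neg (by omega), sub_zero]
    · rw [add_comm d, sum_translate_pow_card_sub_one_add ι c hd0 hd, sub_self, if_neg (by omega)]
  · simp only [if_neg (show ¬ Fintype.card F - 1 - e = Fintype.card F - 1 by omega), ← pow_add]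
    rcases le_or_gt d e with hde | hde
    · rw [sum_translate_pow_eq ι c (by omega)]
      congr 1
      exact propext (by omega)
    · have : d + (Fintype.card F - 1 - e) = Fintype.card F - 1 + (d - e) := by omega
      rw [this, sum_translate_pow_card_sub_one_add ι c (by omega) (by omega),
        sum_translate_pow_eq ι c (by omega), if_neg (by omega), if_neg (by omega)]

end Sums


section Perturbation

variable {F : Type*} [Field F] [Fintype F]

lemma norm_coe_laurent_le (x : F⟦X⟧) {d : ℕ} (hx : ∀ n < d, PowerSeries.coeff n x = 0) :
    ‖(x : F⸨X⸩)‖ ≤ ((Fintype.card F : ℝ)⁻¹) ^ d := by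
  have hv := (LaurentSeries.intValuation_le_iff_coeff_lt_eq_zero F (d := d) x).2 hx
  have hm := (WithZeroMulInt.toNNReal_strictMono (one_lt_card_nnreal F)).monotone hv
  have he : WithZeroMulInt.toNNReal (one_lt_card_nnreal F).ne_zero (WithZero.exp (-(d : ℤ))) =
      ((Fintype.card F : NNReal)⁻¹) ^ d := by
    rw [WithZeroMulInt.toNNReal_neg_apply _ WithZero.exp_ne_zero]
    have hu : Multiplicative.toAdd (WithZero.unzero (WithZero.exp_ne_zero (a := -(d : ℤ)))) =
        -(d : ℤ) := rfl
    rw [hu]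
    simp
  rw [he] at hm
  rw [laurent_norm_eq]
  exact_mod_cast hm

lemma norm_coe_laurent_le_one (x : F⟦X⟧) : ‖(x : F⸨X⸩)‖ ≤ 1 := by
  simpa using norm_coe_laurent_le x (d := 0) (by simp)

lemma norm_coe_laurent_le_inv (x : F⟦X⟧) (hx : PowerSeries.constantCoeff x = 0) :
    ‖(x : F⸨X⸩)‖ ≤ (Fintype.card F : ℝ)⁻¹ := by
  simpa using norm_coe_laurent_le x (d := 1) (by simpa using hx)

variable [TopologicalSpace F]

/-- `g i` is the `i`-th coefficient functional perturbed by power series without constant term,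
which depend only on the coefficients of index `> i` and vanish at `0`. -/
structure IsDigitPerturbation (g : ℕ → C(F⟦X⟧, F⸨X⸩)) (ρ : ℕ → F⟦X⟧ → F⟦X⟧) : Prop where
  apply_eq : ∀ i x, g i x = ((PowerSeries.C (PowerSeries.coeff i x) + ρ i x : F⟦X⟧) : F⸨X⸩)
  constantCoeff_eq_zero : ∀ i x, PowerSeries.constantCoeff (ρ i x) = 0
  eq_of_coeff_eq : ∀ i x y, (∀ j, i < j → PowerSeries.coeff j x = PowerSeries.coeff j y) →
    ρ i x = ρ i y
  map_zero : ∀ i, ρ i 0 = 0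

/-- The `i`-th Cartier operator minus its constant term. -/
def cartierRemainder (i : ℕ) (x : F⟦X⟧) : F⟦X⟧ :=
  cartierOp i (numDigits F i) x - PowerSeries.C (PowerSeries.coeff i x)

omit [TopologicalSpace F] in
lemma cartierRemainder_congr (i : ℕ) (x y : F⟦X⟧)
    (h : ∀ j, i < j → PowerSeries.coeff j x = PowerSeries.coeff j y) :
    cartierRemainder i x = cartierRemainder i y := by
  ext n
  rcases Nat.eq_zero_or_pos n with rfl | hn
  · simp [cartierRemainder, cartierOp, -PowerSeries.coeff_zero_eq_constantCoeff]
  · have hpos : 0 < n * Fintype.card F ^ numDigits F i :=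
      Nat.mul_pos hn (pow_pos Fintype.card_pos _)
    simp [cartierRemainder, cartierOp, PowerSeries.coeff_C, hn.ne',
      h _ (Nat.lt_add_of_pos_left hpos)]

omit [TopologicalSpace F] in
lemma constantCoeff_cartierRemainder (i : ℕ) (x : F⟦X⟧) :
    PowerSeries.constantCoeff (cartierRemainder i x) = 0 := by
  rw [← PowerSeries.coeff_zero_eq_constantCoeff_apply]
  simp [cartierRemainder, cartierOp, -PowerSeries.coeff_zero_eq_constantCoeff]

omit [TopologicalSpace F] in
lemma cartierRemainder_zero (i : ℕ) : cartierRemainder i (0 : F⟦X⟧) = 0 := by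
  ext n
  simp [cartierRemainder, cartierOp]

omit [TopologicalSpace F] in
lemma C_add_pow_card_pow (a : F) (r : F⟦X⟧) (k : ℕ) :
    (PowerSeries.C a + r) ^ Fintype.card F ^ k = PowerSeries.C a + r ^ Fintype.card F ^ k := by
  have ha : PowerSeries.C a ^ Fintype.card F ^ k = PowerSeries.C a := by
    rw [← map_pow, FiniteField.pow_card_pow]
  obtain ⟨p, hp⟩ := CharP.exists F
  obtain ⟨n, hpr, hcard⟩ := FiniteField.card F p
  have : Fact p.Prime := ⟨hpr⟩
  have : CharP F⟦X⟧ p := charP_of_injective_ringHom (PowerSeries.C_injective (R := F)) p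
  have h : (PowerSeries.C a + r) ^ Fintype.card F ^ k =
      PowerSeries.C a ^ Fintype.card F ^ k + r ^ Fintype.card F ^ k := by
    rw [hcard, ← pow_mul, add_pow_char_pow]
  rw [h, ha]

variable [DiscreteTopology F]

lemma isDigitPerturbation_cartierPsi : IsDigitPerturbation (cartierPsi F) cartierRemainder where
  apply_eq i x := by simp [cartierPsi, cartierRemainder]
  constantCoeff_eq_zero := constantCoeff_cartierRemainder
  eq_of_coeff_eq := cartierRemainder_congr
  map_zero := cartierRemainder_zero

lemma isDigitPerturbation_cartierPhi : IsDigitPerturbation (cartierPhi F)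
    fun i x => cartierRemainder i x ^ Fintype.card F ^ numDigits F i where
  apply_eq i x := by
    rw [← C_add_pow_card_pow]
    simp [cartierPhi, cartierRemainder]
  constantCoeff_eq_zero i x := by
    rw [map_pow, constantCoeff_cartierRemainder, zero_pow (pow_pos Fintype.card_pos _).ne']
  eq_of_coeff_eq i x y h := by simp only [cartierRemainder_congr i x y h]
  map_zero i := by
    simp only [cartierRemainder_zero, zero_pow (pow_pos Fintype.card_pos _).ne']

end Perturbation

section Digits

variable {F : Type*} [Field F] [Fintype F]

lemma numDigits_le_iff {n w : ℕ} : numDigits F n ≤ w ↔ n < Fintype.card F ^ w := by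
  rw [numDigits, Nat.digits_length_le_iff Fintype.one_lt_card]

lemma digit_eq_zero {n i : ℕ} (h : numDigits F n ≤ i) :
    n / Fintype.card F ^ i % Fintype.card F = 0 := by
  rw [Nat.div_eq_of_lt (numDigits_le_iff.1 h), Nat.zero_mod]

lemma exists_digit_ne_zero {n w : ℕ} (h : Fintype.card F ^ w ≤ n) :
    ∃ i < numDigits F n, w ≤ i ∧ n / Fintype.card F ^ i % Fintype.card F ≠ 0 := by
  have hw : w < numDigits F n := by
    by_contra hlt
    exact absurd (numDigits_le_iff.1 (not_lt.1 hlt)) (not_lt.2 h)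
  obtain ⟨i, hi⟩ := Nat.exists_eq_add_of_lt hw
  refine ⟨w + i, by omega, by omega, ?_⟩
  have h1 : Fintype.card F ^ (w + i) ≤ n := by
    by_contra hlt
    have := (numDigits_le_iff (F := F)).2 (not_le.1 hlt)
    omega
  have h2 : n < Fintype.card F ^ (w + i + 1) := numDigits_le_iff.1 hi.le
  rw [pow_succ] at h2
  rw [Nat.mod_eq_of_lt (Nat.div_lt_of_lt_mul h2)]
  exact (Nat.div_pos h1 (pow_pos Fintype.card_pos _)).ne'

variable [TopologicalSpace F] (g : ℕ → C(F⟦X⟧, F⸨X⸩))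

lemma digitExt_apply {n w : ℕ} (h : n < Fintype.card F ^ w) (x : F⟦X⟧) :
    digitExt g n x =
      ∏ i ∈ Finset.range w, g i x ^ (n / Fintype.card F ^ i % Fintype.card F) := by
  rw [digitExt, ContinuousMap.prod_apply]
  simp only [ContinuousMap.pow_apply]
  refine Finset.prod_subset (Finset.range_subset_range.2 (numDigits_le_iff.2 h)) fun i _ hi => ?_
  rw [digit_eq_zero (not_lt.1 fun hlt => hi (Finset.mem_range.2 hlt)), pow_zero]

lemma digitExtStar_apply {n w : ℕ} (h : n < Fintype.card F ^ w) (x : F⟦X⟧) :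
    digitExtStar g n x = ∏ i ∈ Finset.range w,
      if n / Fintype.card F ^ i % Fintype.card F = Fintype.card F - 1 then
        g i x ^ (Fintype.card F - 1) - 1
      else g i x ^ (n / Fintype.card F ^ i % Fintype.card F) := by
  have hq := Fintype.one_lt_card (α := F)
  rw [digitExtStar, ContinuousMap.prod_apply]
  rw [← Finset.prod_subset (Finset.range_subset_range.2 (numDigits_le_iff.2 h))]
  · refine Finset.prod_congr rfl fun i _ => ?_
    split_ifs <;> simp
  · intro i _ hi
    rw [digit_eq_zero (not_lt.1 fun hlt => hi (Finset.mem_range.2 hlt)), if_neg (by omega), pow_zero]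

end Digits

section Polynomials

variable {F : Type*} [Field F] [Fintype F]

/-- The polynomial `∑ aᵢ Tⁱ` of degree `< w` with coefficients `a`. -/
def polyOfCoeffs {w : ℕ} (a : Fin w → F) : Polynomial F := ∑ i : Fin w, Polynomial.monomial i (a i)

omit [Fintype F] in
lemma coeff_polyOfCoeffs {w : ℕ} (a : Fin w → F) (i : Fin w) : (polyOfCoeffs a).coeff i = a i := by
  simp [polyOfCoeffs, Polynomial.finsetSum_coeff, Polynomial.coeff_monomial, Fin.val_inj]

omit [Fintype F] in
lemma coeff_polyOfCoeffs_of_le {w : ℕ} (a : Fin w → F) {i : ℕ} (hi : w ≤ i) :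
    (polyOfCoeffs a).coeff i = 0 := by
  rw [polyOfCoeffs, Polynomial.finsetSum_coeff]
  refine Finset.sum_eq_zero fun j _ => ?_
  rw [Polynomial.coeff_monomial, if_neg (by omega)]

lemma mem_polysDegreeLT {w : ℕ} {α : Polynomial F} :
    α ∈ polysDegreeLT F w ↔ ∀ i, w ≤ i → α.coeff i = 0 := by
  simp [polysDegreeLT, Polynomial.degree_lt_iff_coeff_zero]

lemma sum_polysDegreeLT {M : Type*} [AddCommMonoid M] (w : ℕ) (h : Polynomial F → M) :
    ∑ α ∈ polysDegreeLT F w, h α = ∑ a : Fin w → F, h (polyOfCoeffs a) := by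
  symm
  refine Finset.sum_bij' (fun a _ => polyOfCoeffs a) (fun α _ i => α.coeff i) ?_ ?_ ?_ ?_ ?_
  · exact fun a _ => mem_polysDegreeLT.2 fun i hi => coeff_polyOfCoeffs_of_le a hi
  · simp
  · exact fun a _ => funext fun i => coeff_polyOfCoeffs a i
  · intro α hα
    ext i
    rcases lt_or_ge i w with hi | hi
    · exact coeff_polyOfCoeffs (fun j : Fin w => α.coeff j) ⟨i, hi⟩
    · rw [coeff_polyOfCoeffs_of_le _ hi, mem_polysDegreeLT.1 hα i hi]
  · simp

lemma card_polysDegreeLT (w : ℕ) : (polysDegreeLT F w).card = Fintype.card F ^ w := by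
  rw [Finset.card_eq_sum_ones, sum_polysDegreeLT]
  simp

lemma trunc_mem_polysDegreeLT (w : ℕ) (x : F⟦X⟧) : PowerSeries.trunc w x ∈ polysDegreeLT F w :=
  mem_polysDegreeLT.2 fun i hi => by rw [PowerSeries.coeff_trunc, if_neg (not_lt.2 hi)]

end Polynomials

section Main

variable {F : Type*} [Field F] [Fintype F] [TopologicalSpace F]
  {g : ℕ → C(F⟦X⟧, F⸨X⸩)} {ρ : ℕ → F⟦X⟧ → F⟦X⟧}

namespace IsDigitPerturbation

variable (hg : IsDigitPerturbation g ρ)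
include hg

omit [Fintype F] in
lemma apply_eq_zero {i : ℕ} {x : F⟦X⟧} (hx : ∀ j, i ≤ j → PowerSeries.coeff j x = 0) :
    g i x = 0 := by
  rw [hg.apply_eq, hx i le_rfl,
    hg.eq_of_coeff_eq i x 0 fun j hj => by rw [hx j hj.le, _root_.map_zero], hg.map_zero]
  simp

lemma digitExt_eq_zero {n w : ℕ} (hn : Fintype.card F ^ w ≤ n) {α : Polynomial F}
    (hα : α ∈ polysDegreeLT F w) : digitExt g n (α : F⟦X⟧) = 0 := by
  obtain ⟨i, hi, hwi, hd⟩ := exists_digit_ne_zero hn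
  rw [digitExt, ContinuousMap.prod_apply]
  refine Finset.prod_eq_zero (Finset.mem_range.2 hi) ?_
  rw [ContinuousMap.pow_apply, hg.apply_eq_zero fun j hj => ?_, zero_pow hd]
  rw [Polynomial.coeff_coe, mem_polysDegreeLT.1 hα j (hwi.trans hj)]

/-- The biorthogonality relations between `digitExt` and `digitExtStar`. -/
theorem sum_digitExtStar_mul_digitExt {n m w : ℕ} (hn : n < Fintype.card F ^ w)
    (hm : m < Fintype.card F ^ w) :
    ∑ α ∈ polysDegreeLT F w, digitExtStar g (Fintype.card F ^ w - 1 - n) (α : F⟦X⟧) *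
      digitExt g m (α : F⟦X⟧) = (-1) ^ w * if m = n then 1 else 0 := by
  have hq := Fintype.card_pos (α := F)
  let : Inhabited F := ⟨0⟩
  let y : ℕ → (Fin w → F) → F⸨X⸩ := fun i a => g i (polyOfCoeffs a : F⟦X⟧)
  let d : ℕ → ℕ → ℕ := fun k i => k / Fintype.card F ^ i % Fintype.card F
  have hrem : ∀ (i : Fin w) (a b : Fin w → F), (∀ j, i < j → a j = b j) →
      ρ i (polyOfCoeffs a : F⟦X⟧) = ρ i (polyOfCoeffs b : F⟦X⟧) := fun i a b hab => by
    refine hg.eq_of_coeff_eq _ _ _ fun j hj => ?_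
    rw [Polynomial.coeff_coe, Polynomial.coeff_coe]
    rcases lt_or_ge j w with hjw | hjw
    · exact (coeff_polyOfCoeffs a ⟨j, hjw⟩).trans
        ((hab ⟨j, hjw⟩ hj).trans (coeff_polyOfCoeffs b ⟨j, hjw⟩).symm)
    · rw [coeff_polyOfCoeffs_of_le _ hjw, coeff_polyOfCoeffs_of_le _ hjw]
  have hy : ∀ (i : Fin w) (a : Fin w → F), y i a =
      ((HahnSeries.ofPowerSeries ℤ F).comp PowerSeries.C) (a i) +
        (ρ i (polyOfCoeffs a : F⟦X⟧) : F⸨X⸩) := fun i a => by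
    simp only [y, hg.apply_eq, map_add, Polynomial.coeff_coe, coeff_polyOfCoeffs,
      RingHom.comp_apply]
  have htri := sum_prod_eq_prod_of_triangular (w := w)
    (fun i a => y i a ^ d m i * if Fintype.card F - 1 - d n i = Fintype.card F - 1 then
        y i a ^ (Fintype.card F - 1) - 1 else y i a ^ (Fintype.card F - 1 - d n i))
    (fun i => if d m i = d n i then -1 else 0) (fun i a => ?_) (fun i a b hab => ?_)
  · rw [sum_polysDegreeLT]
    refine Eq.trans (Finset.sum_congr rfl fun a _ => ?_) (htri.trans ?_)
    · rw [digitExt_apply g hm, digitExtStar_apply g (w := w) (by omega), mul_comm,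
        ← Finset.prod_mul_distrib, Finset.prod_range]
      refine Finset.prod_congr rfl fun i _ => ?_
      rw [digit_pow_sub_one_sub hq hn i.2]
    · split_ifs with hmn
      · subst hmn
        simp
      · rw [mul_zero]
        have hex : ∃ i < w, d m i ≠ d n i := by
          by_contra hall
          push Not at hall
          exact hmn (eq_of_digits_eq hm hn hall)
        obtain ⟨i, hi, hne⟩ := hex
        exact Finset.prod_eq_zero (Finset.mem_univ ⟨i, hi⟩) (if_neg hne)
  · have hupd : ∀ x : F, y i (Function.update a i x) =
        ((HahnSeries.ofPowerSeries ℤ F).comp PowerSeries.C) x +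
          (ρ i (polyOfCoeffs a : F⟦X⟧) : F⸨X⸩) := fun x => by
      rw [hy, Function.update_self, hrem i _ a fun j hj => Function.update_of_ne hj.ne' _ _]
    simp only [hupd]
    exact sum_digit_factor _ _ (Nat.mod_lt _ hq) (Nat.mod_lt _ hq)
  · have : y i a = y i b := by rw [hy, hy, hab i le_rfl, hrem i a b fun j hj => hab j hj.le]
    simp only [this]

lemma norm_digitExt_apply_le (n : ℕ) (x : F⟦X⟧) : ‖digitExt g n x‖ ≤ 1 := by
  have hmem : digitExt g n x ∈ (HahnSeries.ofPowerSeries ℤ F).range := by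
    rw [digitExt, ContinuousMap.prod_apply]
    exact prod_mem fun i _ => pow_mem (hg.apply_eq i x ▸ ⟨_, rfl⟩) _
  obtain ⟨y, hy⟩ := hmem
  exact hy ▸ norm_coe_laurent_le_one y

lemma norm_digitExtStar_apply_le (n : ℕ) (x : F⟦X⟧) : ‖digitExtStar g n x‖ ≤ 1 := by
  have hmem : digitExtStar g n x ∈ (HahnSeries.ofPowerSeries ℤ F).range := by
    have hgi : ∀ i, g i x ∈ (HahnSeries.ofPowerSeries ℤ F).range :=
      fun i => hg.apply_eq i x ▸ ⟨_, rfl⟩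
    rw [digitExtStar, ContinuousMap.prod_apply]
    refine prod_mem fun i _ => ?_
    split_ifs
    · exact sub_mem (pow_mem (hgi i) _) (one_mem _)
    · exact pow_mem (hgi i) _
  obtain ⟨y, hy⟩ := hmem
  exact hy ▸ norm_coe_laurent_le_one y

lemma norm_digitExt_sub_le {n w : ℕ} (hn : n < Fintype.card F ^ w) {x y : F⟦X⟧}
    (hxy : ∀ i < w, PowerSeries.coeff i x = PowerSeries.coeff i y) :
    ‖digitExt g n x - digitExt g n y‖ ≤ (Fintype.card F : ℝ)⁻¹ := by
  simp only [digitExt_apply g hn, hg.apply_eq, ← map_pow, ← map_prod, ← map_sub]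
  refine norm_coe_laurent_le_inv _ ?_
  simp only [map_sub, map_prod, map_pow, map_add, hg.constantCoeff_eq_zero,
    PowerSeries.constantCoeff_C, add_zero]
  rw [sub_eq_zero]
  exact Finset.prod_congr rfl fun i hi => by rw [hxy i (Finset.mem_range.1 hi)]

end IsDigitPerturbation

/-- The functional `f ↦ (-1)^w ∑ F*_{q^w-1-n}(α) f(α)` giving the `n`-th coefficient. -/
def coeffFunctional (g : ℕ → C(F⟦X⟧, F⸨X⸩)) (w n : ℕ) : C(F⟦X⟧, F⸨X⸩) →ₗ[F⸨X⸩] F⸨X⸩ where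
  toFun f := (-1) ^ w * ∑ α ∈ polysDegreeLT F w,
    digitExtStar g (Fintype.card F ^ w - 1 - n) (α : F⟦X⟧) * f (α : F⟦X⟧)
  map_add' f₁ f₂ := by simp [mul_add, Finset.sum_add_distrib]
  map_smul' r f := by
    simp only [ContinuousMap.smul_apply, smul_eq_mul, Finset.mul_sum, RingHom.id_apply]
    exact Finset.sum_congr rfl fun α _ => by ring

namespace IsDigitPerturbation

variable (hg : IsDigitPerturbation g ρ)
include hg

lemma norm_coeffFunctional_le (w n : ℕ) (f : C(F⟦X⟧, F⸨X⸩)) :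
    ‖coeffFunctional g w n f‖ ≤ ‖f‖ := by
  change ‖(-1 : F⸨X⸩) ^ w * _‖ ≤ _
  rw [norm_mul, norm_pow, norm_neg, norm_one, one_pow, one_mul]
  refine IsUltrametricDist.norm_sum_le_of_forall_le_of_nonneg (norm_nonneg f) fun α _ => ?_
  rw [norm_mul]
  exact (mul_le_mul (hg.norm_digitExtStar_apply_le _ _) (f.norm_coe_le_norm _) (norm_nonneg _)
    zero_le_one).trans_eq (one_mul _)

lemma coeffFunctional_digitExt {n w : ℕ} (hn : n < Fintype.card F ^ w) (m : ℕ) :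
    coeffFunctional g w n (digitExt g m) = if m = n then 1 else 0 := by
  change (-1 : F⸨X⸩) ^ w * _ = _
  rcases lt_or_ge m (Fintype.card F ^ w) with hm | hm
  · rw [hg.sum_digitExtStar_mul_digitExt hn hm, ← mul_assoc, ← mul_pow]
    simp
  · rw [if_neg (by omega), Finset.sum_eq_zero, mul_zero]
    intro α hα
    rw [hg.digitExt_eq_zero hm hα, mul_zero]

/-- Interpolation of `f` at all polynomials of degree `< w`. -/
lemma sum_coeffFunctional_mul_digitExt (f : C(F⟦X⟧, F⸨X⸩)) {w : ℕ} {α : Polynomial F}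
    (hα : α ∈ polysDegreeLT F w) :
    ∑ n ∈ Finset.range (Fintype.card F ^ w), coeffFunctional g w n f * digitExt g n (α : F⟦X⟧) =
      f (α : F⟦X⟧) := by
  classical
  let A : Matrix (polysDegreeLT F w) (Fin (Fintype.card F ^ w)) F⸨X⸩ :=
    Matrix.of fun α n => digitExt g n (α.1 : F⟦X⟧)
  let B : Matrix (Fin (Fintype.card F ^ w)) (polysDegreeLT F w) F⸨X⸩ :=
    Matrix.of fun n α => (-1) ^ w * digitExtStar g (Fintype.card F ^ w - 1 - n) (α.1 : F⟦X⟧)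
  have hBA : B * A = 1 := by
    refine Matrix.ext fun n m => ?_
    rw [Matrix.mul_apply, Matrix.one_apply]
    simp only [A, B, Matrix.of_apply, mul_assoc, ← Finset.mul_sum]
    rw [Finset.sum_coe_sort (polysDegreeLT F w) fun α =>
      digitExtStar g (Fintype.card F ^ w - 1 - n) (α : F⟦X⟧) * digitExt g m (α : F⟦X⟧)]
    refine (hg.coeffFunctional_digitExt n.2 m).trans ?_
    simp only [Fin.val_inj, eq_comm]
  have hAB : A * B = 1 := (Matrix.mul_eq_one_comm_of_card_eq _ _ _
    (by rw [Fintype.card_fin, Fintype.card_coe, card_polysDegreeLT])).1 hBA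
  let fA : polysDegreeLT F w → F⸨X⸩ := fun β => f (β.1 : F⟦X⟧)
  have hB : ∀ n, B.mulVec fA n = coeffFunctional g w n f := fun n => by
    change ∑ β : polysDegreeLT F w, _ * f (β.1 : F⟦X⟧) = (-1) ^ w * _
    rw [Finset.mul_sum, ← Finset.sum_coe_sort (polysDegreeLT F w)]
    exact Finset.sum_congr rfl fun β _ => mul_assoc _ _ _
  have h : A.mulVec (B.mulVec fA) ⟨α, hα⟩ = f (α : F⟦X⟧) := by
    rw [Matrix.mulVec_mulVec, hAB, Matrix.one_mulVec]
  rw [← h, Finset.sum_range]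
  refine Finset.sum_congr rfl fun n _ => ?_
  rw [hB, mul_comm]
  rfl

theorem coeff_eq {f : C(F⟦X⟧, F⸨X⸩)} {c : ℕ → F⸨X⸩} (hc : IsExpansion (digitExt g) c f)
    {n w : ℕ} (hn : n < Fintype.card F ^ w) : c n = coeffFunctional g w n f :=
  hc.eq_dual _ (hg.norm_coeffFunctional_le w n) (hg.coeffFunctional_digitExt hn)

end IsDigitPerturbation

variable [DiscreteTopology F]

lemma exists_norm_sub_le_of_coeff_eq (f : C(F⟦X⟧, F⸨X⸩)) {ε : ℝ} (hε : 0 < ε) :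
    ∃ v : ℕ, ∀ x y : F⟦X⟧, (∀ i < v, PowerSeries.coeff i x = PowerSeries.coeff i y) →
      ‖f x - f y‖ ≤ ε := by
  let : PseudoMetricSpace F⟦X⟧ := (isInducing_coe_laurent (F := F)).comapPseudoMetricSpace
  obtain ⟨δ, hδ, h⟩ := Metric.uniformContinuous_iff.1
    (CompactSpace.uniformContinuous_of_continuous f.continuous) ε hε
  have hq : (1 : ℝ) < (Fintype.card F : ℝ) := by exact_mod_cast Fintype.one_lt_card (α := F)
  obtain ⟨v, hv⟩ := exists_pow_lt_of_lt_one hδ (inv_lt_one_of_one_lt₀ hq)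
  refine ⟨v, fun x y hxy => ?_⟩
  rw [← dist_eq_norm]
  refine (h (lt_of_le_of_lt ?_ hv)).le
  change dist (x : F⸨X⸩) (y : F⸨X⸩) ≤ _
  rw [dist_eq_norm, ← map_sub]
  exact norm_coe_laurent_le _ fun n hn => by rw [map_sub, hxy n hn, sub_self]

namespace IsDigitPerturbation

variable (hg : IsDigitPerturbation g ρ)
include hg

lemma exists_mem_span_norm_sub_le (f : C(F⟦X⟧, F⸨X⸩)) :
    ∃ d ∈ Submodule.span F⸨X⸩ (Set.range (digitExt g)),
      ‖f - d‖ ≤ (Fintype.card F : ℝ)⁻¹ * ‖f‖ := by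
  rcases eq_or_ne f 0 with rfl | hf
  · exact ⟨0, Submodule.zero_mem _, by simp⟩
  have hq : (0 : ℝ) < (Fintype.card F : ℝ)⁻¹ := by
    have := Fintype.card_pos (α := F)
    positivity
  have hε := mul_pos hq (norm_pos_iff.2 hf)
  obtain ⟨v, hv⟩ := exists_norm_sub_le_of_coeff_eq f hε
  refine ⟨∑ n ∈ Finset.range (Fintype.card F ^ v), coeffFunctional g v n f • digitExt g n,
    Submodule.sum_mem _ fun n _ => Submodule.smul_mem _ _ (Submodule.subset_span ⟨n, rfl⟩), ?_⟩
  refine (ContinuousMap.norm_le _ hε.le).2 fun x => ?_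
  have hcoeff : ∀ i < v, PowerSeries.coeff i x =
      PowerSeries.coeff i (PowerSeries.trunc v x : F⟦X⟧) := fun i hi => by
    rw [Polynomial.coeff_coe, PowerSeries.coeff_trunc, if_pos hi]
  have hint := hg.sum_coeffFunctional_mul_digitExt f (trunc_mem_polysDegreeLT v x)
  have heq : (f - ∑ n ∈ Finset.range (Fintype.card F ^ v),
        coeffFunctional g v n f • digitExt g n) x =
      (f x - f (PowerSeries.trunc v x : F⟦X⟧)) +
        -∑ n ∈ Finset.range (Fintype.card F ^ v), coeffFunctional g v n f *
          (digitExt g n x - digitExt g n (PowerSeries.trunc v x : F⟦X⟧)) := by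
    simp only [mul_sub, Finset.sum_sub_distrib, hint, ContinuousMap.sub_apply,
      ContinuousMap.sum_apply, ContinuousMap.smul_apply, smul_eq_mul]
    ring
  rw [heq]
  refine (IsUltrametricDist.norm_add_le_max _ _).trans (max_le (hv _ _ hcoeff) ?_)
  rw [norm_neg]
  refine IsUltrametricDist.norm_sum_le_of_forall_le_of_nonneg hε.le fun n hn => ?_
  rw [norm_mul, mul_comm]
  exact mul_le_mul (hg.norm_digitExt_sub_le (Finset.mem_range.1 hn) hcoeff)
    (hg.norm_coeffFunctional_le v n f) (norm_nonneg _) hq.le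

theorem isOrthonormalBasis_digitExt : IsOrthonormalBasis F⸨X⸩ (digitExt g) := by
  have hq := Fintype.one_lt_card (α := F)
  refine isOrthonormalBasis_of_dual (c := fun n => coeffFunctional g n n)
    (fun n => (ContinuousMap.norm_le _ zero_le_one).2 (hg.norm_digitExt_apply_le n))
    (fun n => hg.norm_coeffFunctional_le n n)
    (fun n => hg.coeffFunctional_digitExt (Nat.lt_pow_self hq))
    (inv_lt_one_of_one_lt₀ (by exact_mod_cast hq)) hg.exists_mem_span_norm_sub_le

end IsDigitPerturbation

end Main

end

theorem theorem3p4 (F : Type*) [Field F] [Fintype F] [TopologicalSpace F] [DiscreteTopology F]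
    (g : ℕ → C(F⟦X⟧, F⸨X⸩)) (hg : g = cartierPhi F ∨ g = cartierPsi F) :
    IsOrthonormalBasis F⸨X⸩ (digitExt g) ∧
    ∀ (f : C(F⟦X⟧, F⸨X⸩)) (c : ℕ → F⸨X⸩), IsExpansion (digitExt g) c f →
      ∀ n w : ℕ, n < Fintype.card F ^ w →
        c n = (-1) ^ w * ∑ α ∈ polysDegreeLT F w,
          digitExtStar g (Fintype.card F ^ w - 1 - n) (α : F⟦X⟧) * f (α : F⟦X⟧) := by
  obtain ⟨ρ, hρ⟩ : ∃ ρ, IsDigitPerturbation g ρ := by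
    rcases hg with rfl | rfl
    · exact ⟨_, isDigitPerturbation_cartierPhi⟩
    · exact ⟨_, isDigitPerturbation_cartierPsi⟩
  exact ⟨hρ.isOrthonormalBasis_digitExt, fun f c hc n w hn => hρ.coeff_eq hc hn⟩
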